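/- Let $\mathbb K\in\{\mathbb R,\mathbb C\}$. Let $E$ be a Hausdorff locally convex space over $\mathbb K$ which is an (LF)-space $E=\operatorname{ind}_n E_n$: that is, $E_0\subset E_1\subset\cdots$ are linear subspaces of $E$ with $\bigcup_n E_n=E$, each $E_n$ carries a Fréchet space topology (complete, metrizable, locally convex), the inclusions $E_n\hookrightarrow E_{n+1}$ are continuous, and $E$ carries the finest locally convex topology making all inclusions $E_n\hookrightarrow E$ continuous. Suppose that $E$ is boundedly retractive: for every bounded set $B\subset E$ there is $m$ such that $B$ is contained and bounded in $E_m$, and $E_m$ and $E$ induce the same topology on $B$. Then every bounded sequence in $E$ has a subsequence $(y_k)_k$ which is either $\sigma(E,E')$-Cauchy (that is, $(f(y_k))_k$ is a Cauchy sequence for every continuous linear functional $f$ on $E$) or equivalent to the unit vector basis $(e_k)_k$ of $\ell_1$ (that is, there is a linear map $T:\ell_1\to E$ which is a topological isomorphism onto its image, with $T e_k=y_k$ for all $k$). In particular, $E$ contains no copy of $\ell_1$ (no linear subspace topologically isomorphic to $\ell_1$) if and only if every bounded sequence in $E$ has a $\sigma(E,E')$-Cauchy subsequence. -/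

import Mathlib

open Filter Topology Bornology

section LFSpaces

/-- `E` is the inductive limit of the increasing sequence of locally convex spaces `F 0, F 1, …`:
each step `F n` is a linear subspace of `E` (through the injective linear map `j n`), each inclusion
`F n ⊆ F (n + 1)` is continuous, the steps exhaust `E`, and the topology of `E` is the finest
locally convex vector space topology for which all inclusions `j n` are continuous. For real or
complex scalars, `PolynormableSpace 𝕜 E` says that `E` is locally convex. -/
structure IsLocallyConvexInductiveLimit {𝕜 : Type*} [RCLike 𝕜]
    {E : Type*} [AddCommGroup E] [Module 𝕜 E] [tE : TopologicalSpace E]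
    {F : ℕ → Type*} [∀ n, AddCommGroup (F n)] [∀ n, Module 𝕜 (F n)]
    [∀ n, TopologicalSpace (F n)] (j : ∀ n, F n →ₗ[𝕜] E) : Prop where
  injective : ∀ n, Function.Injective (j n)
  step : ∀ n, ∃ i : F n →L[𝕜] F (n + 1), ∀ x, j (n + 1) (i x) = j n x
  exhaust : ∀ x : E, ∃ n, x ∈ LinearMap.range (j n)
  continuous_incl : ∀ n, Continuous (j n)
  finest : ∀ t : TopologicalSpace E, IsTopologicalAddGroup E → ContinuousSMul 𝕜 E →
    PolynormableSpace 𝕜 E → (∀ n, Continuous[_, t] (j n)) → tE ≤ t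

/-- Every bounded set `B` of `E` is contained and bounded in some step `F m`, and `F m` and `E`
induce the same topology on `B`. Here `j m ⁻¹' B` is the set `B` viewed inside `F m`, and the last
clause says that its subspace topology from `F m` is the one pulled back from `E`. -/
def IsBoundedlyRetractive {𝕜 : Type*} [RCLike 𝕜]
    {E : Type*} [AddCommGroup E] [Module 𝕜 E] [TopologicalSpace E]
    {F : ℕ → Type*} [∀ n, AddCommGroup (F n)] [∀ n, Module 𝕜 (F n)]
    [∀ n, TopologicalSpace (F n)] (j : ∀ n, F n →ₗ[𝕜] E) : Prop :=
  ∀ B : Set E, IsVonNBounded 𝕜 B →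
    ∃ m, B ⊆ Set.range (j m) ∧ IsVonNBounded 𝕜 (j m ⁻¹' B) ∧
      IsInducing (fun y : (j m ⁻¹' B : Set (F m)) => j m y)

/-- A sequence is `σ(E, E')`-Cauchy. -/
def IsWeaklyCauchySeq (𝕜 : Type*) [RCLike 𝕜] {E : Type*} [AddCommGroup E] [Module 𝕜 E]
    [TopologicalSpace E] (x : ℕ → E) : Prop :=
  ∀ f : E →L[𝕜] 𝕜, CauchySeq (fun k => f (x k))

/-- The sequence `x` is equivalent to the unit vector basis of `ℓ₁`: there is a topological
isomorphism of `ℓ₁` onto a subspace of `E` that maps the `k`-th unit vector to `x k`. -/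
def IsEquivUnitVectorBasisL1 (𝕜 : Type*) [RCLike 𝕜] {E : Type*} [AddCommGroup E] [Module 𝕜 E]
    [TopologicalSpace E] (x : ℕ → E) : Prop :=
  ∃ T : lp (fun _ : ℕ => 𝕜) 1 →L[𝕜] E, IsEmbedding T ∧ ∀ k, T (lp.single 1 k (1 : 𝕜)) = x k

/-- `E` contains a copy of `ℓ₁`: a linear subspace topologically isomorphic to `ℓ₁`. -/
def ContainsCopyL1 (𝕜 : Type*) [RCLike 𝕜] (E : Type*) [AddCommGroup E] [Module 𝕜 E]
    [TopologicalSpace E] : Prop :=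
  ∃ S : Submodule 𝕜 E, Nonempty (lp (fun _ : ℕ => 𝕜) 1 ≃L[𝕜] S)

end LFSpaces

/-! ### Ramsey theory: Galvin's lemma. -/

section GalvinLemma

/-! Rosenthal's dichotomy is proved inside one Fréchet step and then carried over to `E`. Bounded
retractivity is applied not to the sequence alone but to its `seminormHull`, a bounded set that also
contains all its `ℓ₁`-combinations with coefficient norm at most one. In the resulting step `F m`,
`exists_subseq_lower_bound_or_cauchySeq` gives two cases. A subsequence Cauchy under all functionals
on `F m` is weakly Cauchy in `E`, as functionals on `E` restrict to `F m`. Otherwise a seminorm of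
`F m` bounds the combinations below by their `ℓ₁` norm; the image of the unit ball lies in the hull,
where both topologies agree, so a continuous seminorm of `E` gives such a bound too
(`isEquivUnitVectorBasisL1_of_lower_bound`).

Rosenthal's theorem rests on `galvin_lemma`: pairs of sets of functionals, taking values near `c` or
near `d`, have an independent subsequence or one on which no functional is frequently in both sets.
Independence yields the `ℓ₁` bound. Conversely, no subsequence of the basis of `ℓ₁` is weakly
Cauchy, and Hahn–Banach carries this to `E`. -/

/-- The list of the first `k` values of `p`, the latest first. -/
def initialSegment (p : ℕ → ℕ) : ℕ → List ℕ
  | 0 => []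
  | k + 1 => p k :: initialSegment p k

theorem exists_of_mem_initialSegment {p : ℕ → ℕ} {k m : ℕ} (h : m ∈ initialSegment p k) :
    ∃ i < k, p i = m := by
  induction k with
  | zero => simp [initialSegment] at h
  | succ k ih =>
    rcases List.mem_cons.1 h with rfl | h
    · exact ⟨k, k.lt_succ_self, rfl⟩
    · obtain ⟨i, hi, rfl⟩ := ih h
      exact ⟨i, hi.trans k.lt_succ_self, rfl⟩

theorem pairwise_initialSegment {p : ℕ → ℕ} (hp : StrictMono p) (k : ℕ) :
    (initialSegment p k).Pairwise (· > ·) := by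
  induction k with
  | zero => exact List.Pairwise.nil
  | succ k ih =>
    refine List.pairwise_cons.2 ⟨fun m hm => ?_, ih⟩
    obtain ⟨i, hi, rfl⟩ := exists_of_mem_initialSegment hm
    exact hp hi

/-- The lists from which a member of `S` is reached by adding new heads, where at each stage
`U`-almost all heads are allowed. -/
inductive UltraAccepts (U : Filter ℕ) (S : Set (List ℕ)) : List ℕ → Prop
  | of_mem (l : List ℕ) : l ∈ S → UltraAccepts U S l
  | of_cons (l : List ℕ) (D : Set ℕ) : D ∈ U → (∀ n ∈ D, UltraAccepts U S (n :: l)) →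
      UltraAccepts U S l

/-- Each accepted head has its own barrier. A list `t` has finitely many entries, so `D t` may be
intersected with the barriers of all accepted heads occurring in `t`; a sequence obeying the result
obeys the barrier of the head it actually chose. -/
theorem UltraAccepts.exists_barrier {U : Filter ℕ} {S : Set (List ℕ)} {l : List ℕ}
    (h : UltraAccepts U S l) :
    ∃ D : List ℕ → Set ℕ, (∀ t, D t ∈ U) ∧ ∀ (p : ℕ → ℕ) (k : ℕ), initialSegment p k = l →
      (∀ i ≥ k, p i ∈ D (initialSegment p i)) → ∃ i, initialSegment p i ∈ S := by
  induction h with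
  | of_mem l hl => exact ⟨fun _ => Set.univ, fun _ => univ_mem, fun p k hk _ => ⟨k, hk ▸ hl⟩⟩
  | of_cons l D hD _ ih =>
    choose! G hGU hG using ih
    refine ⟨fun t => D ∩ ⋂ n ∈ {n | n ∈ t ∧ n ∈ D}, G n t, fun t => ?_, fun p k hk hp => ?_⟩
    · refine inter_mem hD ((biInter_mem ?_).2 fun n hn => hGU n hn.2 t)
      exact (List.finite_toSet t).subset fun n hn => hn.1
    · have hkD : p k ∈ D := (hp k le_rfl).1
      refine hG (p k) hkD p (k + 1) (by rw [initialSegment, hk]) fun i hi => ?_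
      have hmem : p k ∈ initialSegment p i := by
        clear hp
        induction i, hi using Nat.le_induction with
        | base => exact List.mem_cons_self
        | succ i _ ih => exact List.mem_cons_of_mem _ ih
      exact Set.mem_iInter₂.1 (hp i (by omega)).2 (p k) ⟨hmem, hkD⟩

theorem finite_setOf_pairwise_gt (m : ℕ) :
    {l : List ℕ | l.Pairwise (· > ·) ∧ ∀ x ∈ l, x ≤ m}.Finite := by
  refine ((List.range (m + 1)).reverse.sublists.finite_toSet).subset fun l hl => ?_
  refine List.mem_sublists.2 (List.sublist_of_subperm_of_pairwise ?_ hl.1 ?_)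
  · refine List.subperm_of_subset (hl.1.imp fun h => Nat.ne_of_gt h) fun x hx => ?_
    have := hl.2 x hx
    simp; omega
  · rw [List.pairwise_reverse]
    exact List.pairwise_lt_range

/-- Fusion along a nonprincipal filter. -/
theorem exists_strictMono_forall_mem {U : Filter ℕ} [U.NeBot] (hU : U ≤ Filter.cofinite)
    (D : List ℕ → Set ℕ) (hD : ∀ l, D l ∈ U) :
    ∃ h : ℕ → ℕ, StrictMono h ∧ ∀ l : List ℕ, (∀ x ∈ l, x ∈ Set.range h) →
      l.Pairwise (· > ·) → ∀ k, (∀ x ∈ l, x < h k) → h k ∈ D l := by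
  have step : ∀ m : ℕ, ∃ n, m < n ∧
      ∀ l : List ℕ, l.Pairwise (· > ·) → (∀ x ∈ l, x ≤ m) → n ∈ D l := by
    intro m
    have h1 : Set.Ioi m ∈ U := hU (by
      rw [mem_cofinite, Set.compl_Ioi]; exact Set.finite_Iic m)
    have h2 : (⋂ l ∈ {l : List ℕ | l.Pairwise (· > ·) ∧ ∀ x ∈ l, x ≤ m}, D l) ∈ U :=
      (biInter_mem (finite_setOf_pairwise_gt m)).2 fun l _ => hD l
    obtain ⟨n, hn1, hn2⟩ := nonempty_of_mem (inter_mem h1 h2)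
    exact ⟨n, hn1, fun l hl hlm => Set.mem_iInter₂.1 hn2 l ⟨hl, hlm⟩⟩
  choose g hg hgD using step
  obtain ⟨n₀, hn₀⟩ := nonempty_of_mem (hD [])
  let h : ℕ → ℕ := fun k => g^[k] n₀
  have hsucc : ∀ k, h (k + 1) = g (h k) := fun k => Function.iterate_succ_apply' g k n₀
  have hmono : StrictMono h := strictMono_nat_of_lt_succ fun k => by rw [hsucc]; exact hg _
  refine ⟨h, hmono, fun l hl hpl k hk => ?_⟩
  cases k with
  | zero =>
    have : l = [] := List.eq_nil_iff_forall_not_mem.2 fun x hx => by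
      obtain ⟨i, rfl⟩ := hl x hx
      exact absurd (hmono.lt_iff_lt.1 (hk _ hx)) (Nat.not_lt_zero i)
    subst this
    exact hn₀
  | succ k =>
    rw [hsucc]
    refine hgD _ l hpl fun x hx => ?_
    obtain ⟨i, rfl⟩ := hl x hx
    exact hmono.monotone (Nat.lt_succ_iff.1 (hmono.lt_iff_lt.1 (hk _ hx)))

/-- **Galvin's lemma**: for a family `S` of finite sets of natural numbers (written as decreasing
lists) there is an infinite set `H` such that either no finite subset of `H` is in `S` or every
infinite subset of `H` has an initial segment in `S`. -/
theorem galvin_lemma (S : Set (List ℕ)) :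
    ∃ h : ℕ → ℕ, StrictMono h ∧
      ((∀ l : List ℕ, l.Pairwise (· > ·) → (∀ x ∈ l, x ∈ Set.range h) → l ∉ S) ∨
        ∀ p : ℕ → ℕ, StrictMono p → (∀ i, p i ∈ Set.range h) →
          ∃ i, initialSegment p i ∈ S) := by
  have hU : (hyperfilter ℕ : Filter ℕ) ≤ Filter.cofinite := hyperfilter_le_cofinite
  by_cases hS : UltraAccepts (hyperfilter ℕ) S []
  · obtain ⟨D, hD, hDS⟩ := hS.exists_barrier
    obtain ⟨h, hh, hhD⟩ := exists_strictMono_forall_mem hU D hD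
    refine ⟨h, hh, Or.inr fun p hp hpr => hDS p 0 rfl fun i _ => ?_⟩
    obtain ⟨k, hk⟩ := hpr i
    rw [← hk]
    refine hhD _ (fun x hx => ?_) (pairwise_initialSegment hp i) k fun x hx => ?_
    · obtain ⟨i, -, rfl⟩ := exists_of_mem_initialSegment hx
      exact hpr i
    · obtain ⟨i', hi', rfl⟩ := exists_of_mem_initialSegment hx
      rw [hk]
      exact hp hi'
  -- Rejection persists for almost all new heads: over an ultrafilter, the alternative is that
  -- almost all heads are accepted, which would make `l` accepted.
  · have hD : ∀ l, {n | ¬ UltraAccepts (hyperfilter ℕ) S l →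
        ¬ UltraAccepts (hyperfilter ℕ) S (n :: l)} ∈ (hyperfilter ℕ : Filter ℕ) := by
      intro l
      by_cases hl : UltraAccepts (hyperfilter ℕ) S l
      · simp [hl]
      · simp only [hl, not_false_eq_true, forall_const]
        exact Ultrafilter.compl_mem_iff_notMem.2 fun hmem =>
          hl (UltraAccepts.of_cons l _ hmem fun n hn => hn)
    obtain ⟨h, hh, hhD⟩ := exists_strictMono_forall_mem hU _ hD
    refine ⟨h, hh, Or.inl fun l hpl hl hlS => ?_⟩
    suffices ¬ UltraAccepts (hyperfilter ℕ) S l from this (UltraAccepts.of_mem l hlS)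
    clear hlS
    induction l with
    | nil => exact hS
    | cons n l ih =>
      rw [List.pairwise_cons] at hpl
      have hl' : ∀ x ∈ l, x ∈ Set.range h := fun x hx => hl x (List.mem_cons_of_mem _ hx)
      obtain ⟨k, rfl⟩ := hl n List.mem_cons_self
      exact hhD l hl' hpl.2 k hpl.1 (ih hpl.2 hl')

end GalvinLemma

/-! ### Independent pairs of sets versus convergence. -/

section Dichotomy

variable {K : Type*}

/-- The sequence of pairs `(A n, B n)` is (Boolean) independent. -/
def IsIndependentPairs (A B : ℕ → Set K) : Prop :=
  ∀ (N : ℕ) (c : ℕ → Prop), ∃ t, ∀ n < N, (c n → t ∈ A n) ∧ (¬ c n → t ∈ B n)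

/-- `t` belongs alternately to the `A n` and the `B n`, for `n` running through the list. -/
def AlternatesOn (A B : ℕ → Set K) (t : K) : List ℕ → Prop
  | [] => True
  | n :: l => AlternatesOn A B t l ∧ (Even l.length → t ∈ A n) ∧ (¬ Even l.length → t ∈ B n)

theorem length_initialSegment (p : ℕ → ℕ) (k : ℕ) : (initialSegment p k).length = k := by
  induction k with
  | zero => rfl
  | succ k ih => simp [initialSegment, ih]

/-- Galvin's lemma is applied to the lists on which no point alternates. A point frequently in both
kinds of sets would alternate along some subsequence, contradicting the second alternative. -/
theorem exists_subseq_independent_or_convergent (A B : ℕ → Set K) :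
    ∃ φ : ℕ → ℕ, StrictMono φ ∧
      (IsIndependentPairs (A ∘ φ) (B ∘ φ) ∨
        ∀ t, ¬ ((∃ᶠ n in atTop, t ∈ A (φ n)) ∧ ∃ᶠ n in atTop, t ∈ B (φ n))) := by
  obtain ⟨h, hh, hS | hS⟩ := galvin_lemma {l | ¬ ∃ t, AlternatesOn A B t l}
  -- The neighbours `3n` and `3n + 2` are fillers: pairing `3n + 1` with the later one puts it at an
  -- even place (`A`), with the earlier one at an odd place (`B`), so alternation realizes any
  -- pattern `c`.
  · refine ⟨fun n => h (3 * n + 1), fun a b hab => hh (by omega), Or.inl fun N c => ?_⟩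
    have key : ∀ N : ℕ, ∃ l : List ℕ, l.Pairwise (· > ·) ∧ l.length = 2 * N ∧
        (∀ x ∈ l, ∃ i < 3 * N, h i = x) ∧ ∀ t, AlternatesOn A B t l →
          ∀ n < N, (c n → t ∈ A (h (3 * n + 1))) ∧ (¬ c n → t ∈ B (h (3 * n + 1))) := by
      intro N
      induction N with
      | zero => exact ⟨[], List.Pairwise.nil, rfl, by simp, by simp⟩
      | succ N ih =>
        obtain ⟨l, hl, hlen, hmem, hl'⟩ := ih
        have hev : Even l.length := by simp [hlen]
        have hodd : ¬ Even (l.length + 1) := by simp [Nat.even_add_one, hev]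
        have pw : ∀ i i', 3 * N ≤ i → i < i' → (h i' :: h i :: l).Pairwise (· > ·) := by
          intro i i' hi hii
          have hlt : ∀ x ∈ l, x < h i := fun x hx => by
            obtain ⟨k, hk, rfl⟩ := hmem x hx
            exact hh (by omega)
          refine List.pairwise_cons.2 ⟨fun x hx => ?_, List.pairwise_cons.2 ⟨hlt, hl⟩⟩
          rcases List.mem_cons.1 hx with rfl | hx
          · exact hh hii
          · exact (hlt x hx).trans (hh hii)
        have mm : ∀ i i', i < 3 * N + 3 → i' < 3 * N + 3 →
            ∀ x ∈ h i' :: h i :: l, ∃ k < 3 * (N + 1), h k = x := by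
          intro i i' hi hi' x hx
          rcases List.mem_cons.1 hx with rfl | hx
          · exact ⟨i', by omega, rfl⟩
          rcases List.mem_cons.1 hx with rfl | hx
          · exact ⟨i, by omega, rfl⟩
          obtain ⟨k, hk, rfl⟩ := hmem x hx
          exact ⟨k, by omega, rfl⟩
        by_cases hc : c N
        · refine ⟨h (3 * N + 2) :: h (3 * N + 1) :: l, pw _ _ (by omega) (by omega),
            by simp [hlen]; omega, mm _ _ (by omega) (by omega), fun t ht n hn => ?_⟩
          rcases Nat.lt_succ_iff_lt_or_eq.1 hn with hn | rfl
          · exact hl' t ht.1.1 n hn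
          · exact ⟨fun _ => ht.1.2.1 hev, fun h => absurd hc h⟩
        · refine ⟨h (3 * N + 1) :: h (3 * N) :: l, pw _ _ (by omega) (by omega),
            by simp [hlen]; omega, mm _ _ (by omega) (by omega), fun t ht n hn => ?_⟩
          rcases Nat.lt_succ_iff_lt_or_eq.1 hn with hn | rfl
          · exact hl' t ht.1.1 n hn
          · exact ⟨fun h => absurd h hc, fun _ => ht.2.2 hodd⟩
    obtain ⟨l, hl, -, hmem, hl'⟩ := key N
    obtain ⟨t, ht⟩ := not_not.1 (hS l hl fun x hx => by
      obtain ⟨i, -, rfl⟩ := hmem x hx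
      exact ⟨i, rfl⟩)
    exact ⟨t, hl' t ht⟩
  · refine ⟨h, hh, Or.inr fun t ⟨hA, hB⟩ => ?_⟩
    obtain ⟨ψ, hψ, hAB⟩ := extraction_forall_of_frequently
      (P := fun k n => (Even k → t ∈ A (h n)) ∧ (¬ Even k → t ∈ B (h n))) (fun k => by
        by_cases hk : Even k
        · simpa [hk] using hA
        · simpa [hk] using hB)
    obtain ⟨i, hi⟩ := hS (h ∘ ψ) (hh.comp hψ) fun i => ⟨ψ i, rfl⟩
    refine hi ⟨t, ?_⟩
    clear hi
    induction i with
    | zero => trivial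
    | succ i ih =>
      refine ⟨ih, ?_⟩
      rw [length_initialSegment]
      exact hAB i

end Dichotomy

/-! ### Diagonal extraction over countably many families. -/

section Diagonal

/-- Diagonal extraction of a subsequence. -/
theorem exists_diagonal_subseq {P : ℕ → (ℕ → ℕ) → Prop}
    (hP : ∀ (q : ℕ) (φ : ℕ → ℕ), StrictMono φ → ∃ ψ : ℕ → ℕ, StrictMono ψ ∧ P q (φ ∘ ψ)) :
    ∃ δ : ℕ → ℕ, StrictMono δ ∧
      ∀ q, ∃ φ : ℕ → ℕ, StrictMono φ ∧ P q φ ∧ ∀ n > q, ∃ m ≥ n, δ n = φ m := by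
  choose! g hg hgP using hP
  let Φ : ℕ → ℕ → ℕ := fun k => Nat.rec id (fun k φ => φ ∘ g k φ) k
  have hsucc : ∀ k, Φ (k + 1) = Φ k ∘ g k (Φ k) := fun k => rfl
  have hmono : ∀ k, StrictMono (Φ k) := by
    intro k
    induction k with
    | zero => exact strictMono_id
    | succ k ih => exact ih.comp (hg k _ ih)
  have hfac : ∀ k n, k ≤ n → ∃ χ : ℕ → ℕ, StrictMono χ ∧ Φ n = Φ k ∘ χ := by
    intro k n hkn
    induction n, hkn using Nat.le_induction with
    | base => exact ⟨id, strictMono_id, rfl⟩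
    | succ n _ ih =>
      obtain ⟨χ, hχ, h⟩ := ih
      exact ⟨χ ∘ g n (Φ n), hχ.comp (hg n _ (hmono n)), by
        rw [hsucc, ← Function.comp_assoc, ← h]⟩
  refine ⟨fun k => Φ k k, strictMono_nat_of_lt_succ fun k => ?_, fun q =>
    ⟨Φ (q + 1), hmono (q + 1), hgP q _ (hmono q), fun n hn => ?_⟩⟩
  · rw [hsucc]
    exact hmono k (k.lt_succ_self.trans_le ((hg k _ (hmono k)).le_apply))
  · obtain ⟨χ, hχ, h⟩ := hfac (q + 1) n hn
    exact ⟨χ n, hχ.le_apply, congrFun h n⟩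

/-- If no subsequence is independent for any index, every application of the dichotomy gives the
convergent case, and frequent membership along the diagonal passes back to each stage. -/
theorem exists_independent_or_forall_convergent {K ι : Type*} [Countable ι] [Nonempty ι]
    (A B : ι → ℕ → Set K) :
    ∃ φ : ℕ → ℕ, StrictMono φ ∧
      ((∃ q, IsIndependentPairs (A q ∘ φ) (B q ∘ φ)) ∨
        ∀ q t, ¬ ((∃ᶠ n in atTop, t ∈ A q (φ n)) ∧ ∃ᶠ n in atTop, t ∈ B q (φ n))) := by
  by_cases hind : ∃ φ : ℕ → ℕ, StrictMono φ ∧ ∃ q, IsIndependentPairs (A q ∘ φ) (B q ∘ φ)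
  · obtain ⟨φ, hφ, h⟩ := hind
    exact ⟨φ, hφ, Or.inl h⟩
  obtain ⟨e, he⟩ := exists_surjective_nat ι
  obtain ⟨δ, hδ, h⟩ := exists_diagonal_subseq (P := fun k φ => ∀ t,
      ¬ ((∃ᶠ n in atTop, t ∈ A (e k) (φ n)) ∧ ∃ᶠ n in atTop, t ∈ B (e k) (φ n))) (by
    intro k φ hφ
    obtain ⟨ψ, hψ, h | h⟩ :=
      exists_subseq_independent_or_convergent (A (e k) ∘ φ) (B (e k) ∘ φ)
    · exact absurd ⟨φ ∘ ψ, hφ.comp hψ, e k, h⟩ hind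
    · exact ⟨ψ, hψ, h⟩)
  refine ⟨δ, hδ, Or.inr fun q t ⟨hA, hB⟩ => ?_⟩
  obtain ⟨k, rfl⟩ := he q
  obtain ⟨φ, -, hconv, hfac⟩ := h k
  have transfer : ∀ C : ℕ → Set K, (∃ᶠ n in atTop, t ∈ C (δ n)) →
      ∃ᶠ n in atTop, t ∈ C (φ n) := by
    intro C hC
    rw [frequently_atTop] at hC ⊢
    intro N
    obtain ⟨n, hn, htn⟩ := hC (max N (k + 1))
    obtain ⟨m, hm, hmn⟩ := hfac n (lt_of_lt_of_le k.lt_succ_self ((le_max_right _ _).trans hn))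
    exact ⟨m, ((le_max_left _ _).trans hn).trans hm, hmn ▸ htn⟩
  exact hconv t ⟨transfer _ hA, transfer _ hB⟩

end Diagonal

/-! ### Rosenthal's theorem for countably many seminorms. -/

section Rosenthal

variable {𝕜 : Type*} [RCLike 𝕜] {V : Type*} [AddCommGroup V] [Module 𝕜 V]

theorem norm_le_abs_re_add_abs_im (z : 𝕜) : ‖z‖ ≤ |RCLike.re z| + |RCLike.im z| := by
  have hI : ‖(RCLike.I : 𝕜)‖ ≤ 1 := by
    rcases RCLike.I_eq_zero_or_im_I_eq_one (K := 𝕜) with h0 | h0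
    · simp [h0]
    · exact (RCLike.norm_I_of_ne_zero fun h1 => by simp [h1] at h0).le
  calc ‖z‖ = ‖(RCLike.re z : 𝕜) + RCLike.im z * RCLike.I‖ := by rw [RCLike.re_add_im]
    _ ≤ |RCLike.re z| + |RCLike.im z| * ‖(RCLike.I : 𝕜)‖ := by
      refine (norm_add_le _ _).trans_eq ?_
      rw [norm_mul, RCLike.norm_ofReal, RCLike.norm_ofReal]
    _ ≤ |RCLike.re z| + |RCLike.im z| := by
      gcongr
      exact mul_le_of_le_one_right (abs_nonneg _) hI

/-- The linear functionals of absolute value at most `p` with a value near `c` at `v`. -/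
def polarNear (p : Seminorm 𝕜 V) (c : 𝕜) (r : ℝ) (v : V) : Set (V →ₗ[𝕜] 𝕜) :=
  {f | (∀ w, ‖f w‖ ≤ p w) ∧ ‖f v - c‖ < r}

/-- Two functionals with opposite choices of `c` and `d`, made by the sign of `re (b i)`, differ at
`x i` by nearly `±(c - d)`; testing the sum against this difference bounds it below. -/
theorem exists_lower_bound_re (p : Seminorm 𝕜 V) (x : ℕ → V) (c d : 𝕜) (hcd : c ≠ d)
    (h : IsIndependentPairs (fun n => polarNear p c (‖c - d‖ / 16) (x n))
      fun n => polarNear p d (‖c - d‖ / 16) (x n)) (s : Finset ℕ) (b : ℕ → 𝕜) :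
    ‖c - d‖ * (∑ i ∈ s, |RCLike.re (b i)| -
      (∑ i ∈ s, |RCLike.re (b i)| + ∑ i ∈ s, |RCLike.im (b i)|) / 8) ≤
        2 * p (∑ i ∈ s, b i • x i) := by
  set ρ := ‖c - d‖ with hρ
  have hρ0 : 0 < ρ := norm_pos_iff.2 (sub_ne_zero.2 hcd)
  -- The `+ 1` covers all of `s`, and also index `0` when `s` is empty, which supplies the bound of
  -- `f` by `p`.
  obtain ⟨f, hf⟩ := h (s.sup id + 1) fun n => 0 ≤ RCLike.re (b n)
  obtain ⟨f', hf'⟩ := h (s.sup id + 1) fun n => ¬ 0 ≤ RCLike.re (b n)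
  have hlt : ∀ i ∈ s, i < s.sup id + 1 := fun i hi =>
    Nat.lt_succ_of_le (Finset.le_sup (f := id) hi)
  have hpf : ∀ w, ‖f w‖ ≤ p w := by
    by_cases h0 : 0 ≤ RCLike.re (b 0)
    · exact ((hf 0 (by omega)).1 h0).1
    · exact ((hf 0 (by omega)).2 h0).1
  have hpf' : ∀ w, ‖f' w‖ ≤ p w := by
    by_cases h0 : 0 ≤ RCLike.re (b 0)
    · exact ((hf' 0 (by omega)).2 (not_not.2 h0)).1
    · exact ((hf' 0 (by omega)).1 h0).1
  -- The unimodular factor rotating `c - d` onto the positive real axis.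
  set u : 𝕜 := (starRingEnd 𝕜) (c - d) / (ρ : 𝕜) with hu
  have hρ' : (ρ : 𝕜) ≠ 0 := RCLike.ofReal_ne_zero.2 hρ0.ne'
  have hu1 : ‖u‖ = 1 := by
    rw [hu, norm_div, RCLike.norm_conj, RCLike.norm_ofReal, abs_of_pos hρ0, ← hρ,
      div_self hρ0.ne']
  have huc : u * (c - d) = (ρ : 𝕜) := by
    rw [hu, div_mul_eq_mul_div, RCLike.conj_mul, ← hρ, pow_two, mul_div_assoc, div_self hρ',
      mul_one]
  have hterm : ∀ i ∈ s, ρ * (|RCLike.re (b i)| -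
      (|RCLike.re (b i)| + |RCLike.im (b i)|) / 8) ≤
        RCLike.re (u * (b i * (f (x i) - f' (x i)))) := by
    intro i hi
    have hb := norm_le_abs_re_add_abs_im (b i)
    have main : ∀ (σ : ℝ) (z : 𝕜), σ * RCLike.re (b i) = |RCLike.re (b i)| →
        ‖z - (σ : 𝕜) * (c - d)‖ ≤ ρ / 8 →
        ρ * (|RCLike.re (b i)| - (|RCLike.re (b i)| + |RCLike.im (b i)|) / 8) ≤
          RCLike.re (u * (b i * z)) := by
      intro σ z hσ hz
      have e : u * (b i * z) = ((σ * ρ : ℝ) : 𝕜) * b i + u * (b i * (z - (σ : 𝕜) * (c - d))) := by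
        rw [RCLike.ofReal_mul]
        linear_combination (σ : 𝕜) * b i * huc
      have h1 : ‖u * (b i * (z - (σ : 𝕜) * (c - d)))‖ ≤ ‖b i‖ * (ρ / 8) := by
        rw [norm_mul, hu1, one_mul, norm_mul]
        exact mul_le_mul_of_nonneg_left hz (norm_nonneg _)
      have h2 := (abs_le.1 ((RCLike.abs_re_le_norm _).trans h1)).1
      have h3 : ‖b i‖ * (ρ / 8) ≤ (|RCLike.re (b i)| + |RCLike.im (b i)|) * (ρ / 8) :=
        mul_le_mul_of_nonneg_right hb (by positivity)
      rw [e, map_add, RCLike.re_ofReal_mul, mul_right_comm, hσ]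
      linarith
    by_cases h0 : 0 ≤ RCLike.re (b i)
    · have h1 := ((hf i (hlt i hi)).1 h0).2
      have h2 := ((hf' i (hlt i hi)).2 (not_not.2 h0)).2
      refine main 1 _ (by rw [one_mul, abs_of_nonneg h0]) ?_
      have e : f (x i) - f' (x i) - ((1 : ℝ) : 𝕜) * (c - d) =
          (f (x i) - c) - (f' (x i) - d) := by push_cast; ring
      rw [e]
      linarith [norm_sub_le (f (x i) - c) (f' (x i) - d)]
    · have h1 := ((hf i (hlt i hi)).2 h0).2
      have h2 := ((hf' i (hlt i hi)).1 h0).2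
      refine main (-1) _ (by rw [abs_of_neg (not_le.1 h0)]; ring) ?_
      have e : f (x i) - f' (x i) - ((-1 : ℝ) : 𝕜) * (c - d) =
          (f (x i) - d) - (f' (x i) - c) := by push_cast; ring
      rw [e]
      linarith [norm_sub_le (f (x i) - d) (f' (x i) - c)]
  have hsum := Finset.sum_le_sum hterm
  rw [← Finset.mul_sum, Finset.sum_sub_distrib, ← Finset.sum_div, Finset.sum_add_distrib,
    ← map_sum, ← Finset.mul_sum] at hsum
  refine hsum.trans ((RCLike.re_le_norm _).trans ?_)
  have e : ∑ i ∈ s, b i * (f (x i) - f' (x i)) =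
      f (∑ i ∈ s, b i • x i) - f' (∑ i ∈ s, b i • x i) := by
    simp [mul_sub]
  rw [norm_mul, hu1, one_mul, e]
  linarith [norm_sub_le (f (∑ i ∈ s, b i • x i)) (f' (∑ i ∈ s, b i • x i)),
    hpf (∑ i ∈ s, b i • x i), hpf' (∑ i ∈ s, b i • x i)]

/-- Multiplying the coefficients by `I` exchanges real and imaginary parts up to sign; over the
reals `I = 0` and the imaginary parts vanish. Adding both estimates gives `(3/4) ‖c - d‖ ∑ ‖a i‖ ≤ 4
p`, whence `3/16`. -/
theorem exists_lower_bound_of_independent (p : Seminorm 𝕜 V) (x : ℕ → V) (c d : 𝕜)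
    (h : IsIndependentPairs (fun n => polarNear p c (‖c - d‖ / 16) (x n))
      fun n => polarNear p d (‖c - d‖ / 16) (x n)) :
    ∃ δ > 0, ∀ (s : Finset ℕ) (a : ℕ → 𝕜), δ * ∑ i ∈ s, ‖a i‖ ≤ p (∑ i ∈ s, a i • x i) := by
  have hρ0 : 0 < ‖c - d‖ := by
    obtain ⟨f, hf⟩ := h 1 fun _ => True
    linarith [norm_nonneg (f (x 0) - c), ((hf 0 one_pos).1 trivial).2]
  have hcd : c ≠ d := sub_ne_zero.1 (norm_pos_iff.1 hρ0)
  refine ⟨3 * ‖c - d‖ / 16, by positivity, fun s a => ?_⟩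
  have hre := exists_lower_bound_re p x c d hcd h s a
  have him := exists_lower_bound_re p x c d hcd h s fun i => RCLike.I * a i
  have hI : ‖(RCLike.I : 𝕜)‖ ≤ 1 := by
    rcases RCLike.I_eq_zero_or_im_I_eq_one (K := 𝕜) with h0 | h0
    · simp [h0]
    · exact (RCLike.norm_I_of_ne_zero fun h1 => by simp [h1] at h0).le
  have e1 : ∀ i, |RCLike.re (RCLike.I * a i)| = |RCLike.im (a i)| := fun i => by
    rcases RCLike.I_eq_zero_or_im_I_eq_one (K := 𝕜) with h0 | h0
    · have : RCLike.im (a i) = 0 := by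
        rw [← RCLike.re_add_im (a i), h0]
        simp
      simp [h0, this]
    · simp [RCLike.mul_re, h0]
  have e2 : ∀ i, |RCLike.im (RCLike.I * a i)| ≤ |RCLike.re (a i)| := fun i => by
    rw [RCLike.mul_im, RCLike.I_re, zero_mul, zero_add, abs_mul]
    exact mul_le_of_le_one_left (abs_nonneg _) ((RCLike.abs_im_le_norm _).trans hI)
  have e3 : p (∑ i ∈ s, (RCLike.I * a i) • x i) ≤ p (∑ i ∈ s, a i • x i) := by
    simp_rw [mul_smul]
    rw [← Finset.smul_sum, map_smul_eq_mul]
    exact mul_le_of_le_one_left (apply_nonneg _ _) hI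
  simp_rw [e1] at him
  have e4 : ∑ i ∈ s, |RCLike.im (RCLike.I * a i)| ≤ ∑ i ∈ s, |RCLike.re (a i)| :=
    Finset.sum_le_sum fun i _ => e2 i
  have e5 : ∑ i ∈ s, ‖a i‖ ≤ ∑ i ∈ s, |RCLike.re (a i)| + ∑ i ∈ s, |RCLike.im (a i)| := by
    rw [← Finset.sum_add_distrib]
    exact Finset.sum_le_sum fun i _ => norm_le_abs_re_add_abs_im (a i)
  set R := ∑ i ∈ s, |RCLike.re (a i)|
  set J := ∑ i ∈ s, |RCLike.im (a i)|
  have h1 : ‖c - d‖ * (J - (J + R) / 8) ≤ 2 * p (∑ i ∈ s, a i • x i) := by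
    refine le_trans ?_ (him.trans (by linarith))
    refine mul_le_mul_of_nonneg_left ?_ hρ0.le
    linarith
  have h2 : ‖c - d‖ * ∑ i ∈ s, ‖a i‖ ≤ ‖c - d‖ * (R + J) :=
    mul_le_mul_of_nonneg_left e5 hρ0.le
  linarith

theorem exists_two_frequent_values {u : ℕ → 𝕜} {M : ℝ} (hM : ∀ n, ‖u n‖ ≤ M)
    (hu : ¬ CauchySeq u) : ∃ a b : 𝕜, a ≠ b ∧
      ∀ ε > 0, (∃ᶠ n in atTop, ‖u n - a‖ < ε) ∧ ∃ᶠ n in atTop, ‖u n - b‖ < ε := by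
  have hK : IsCompact (Metric.closedBall (0 : 𝕜) M) := isCompact_closedBall 0 M
  have hev : ∀ᶠ n in atTop, u n ∈ Metric.closedBall (0 : 𝕜) M :=
    Eventually.of_forall fun n => by simpa using hM n
  have hfreq : ∀ a, MapClusterPt a atTop u → ∀ ε > 0, ∃ᶠ n in atTop, ‖u n - a‖ < ε := by
    intro a ha ε hε
    have := ha.frequently (Metric.ball_mem_nhds a hε)
    simpa [dist_eq_norm] using this
  obtain ⟨a, -, ha⟩ := hK.exists_mapClusterPt (f := atTop) (u := u) (tendsto_principal.2 hev)
  by_contra! hcon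
  refine hu (Tendsto.cauchySeq (x := a) ?_)
  refine hK.tendsto_nhds_of_unique_mapClusterPt hev fun b _ hb => ?_
  by_contra hab
  obtain ⟨ε, hε, h⟩ := hcon a b (Ne.symm hab)
  exact hfreq b hb ε hε ((h (hfreq a ha ε hε)).mono fun n hn => not_lt.2 hn)

/-- **Rosenthal's `ℓ₁` theorem** for a sequence that is bounded for countably many seminorms, with
real or complex scalars. -/
theorem exists_subseq_lower_bound_or_cauchySeq (p : ℕ → Seminorm 𝕜 V) (x : ℕ → V)
    (hx : ∀ k, ∃ M, ∀ n, p k (x n) ≤ M) :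
    ∃ φ : ℕ → ℕ, StrictMono φ ∧
      ((∃ k, ∃ δ > 0, ∀ (s : Finset ℕ) (a : ℕ → 𝕜),
          δ * ∑ i ∈ s, ‖a i‖ ≤ p k (∑ i ∈ s, a i • x (φ i))) ∨
        ∀ f : V →ₗ[𝕜] 𝕜, (∃ k, ∀ v, ‖f v‖ ≤ p k v) → CauchySeq fun n => f (x (φ n))) := by
  let e : ℕ → 𝕜 := TopologicalSpace.denseSeq 𝕜
  have he : DenseRange e := TopologicalSpace.denseRange_denseSeq 𝕜
  obtain ⟨φ, hφ, ⟨q, h⟩ | h⟩ := exists_independent_or_forall_convergent (ι := ℕ × ℕ × ℕ)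
    (fun q n => polarNear (p q.1) (e q.2.1) (‖e q.2.1 - e q.2.2‖ / 16) (x n))
    (fun q n => polarNear (p q.1) (e q.2.2) (‖e q.2.1 - e q.2.2‖ / 16) (x n))
  · exact ⟨φ, hφ, Or.inl ⟨q.1, exists_lower_bound_of_independent _ (x ∘ φ) _ _ h⟩⟩
  refine ⟨φ, hφ, Or.inr fun f ⟨k, hf⟩ => ?_⟩
  by_contra hu
  obtain ⟨M, hM⟩ := hx k
  obtain ⟨a, b, hab, hfr⟩ := exists_two_frequent_values (M := M)
    (fun n => (hf _).trans (hM (φ n))) hu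
  have hd : 0 < dist a b := dist_pos.2 hab
  -- Values within `1/100` of `dist a b` from a cluster point are within `2/100` of its
  -- approximation, and this is less than `(98/100)/16`.
  obtain ⟨i, hi⟩ := he.exists_dist_lt a (show 0 < dist a b / 100 by positivity)
  obtain ⟨l, hl⟩ := he.exists_dist_lt b (show 0 < dist a b / 100 by positivity)
  have h1 : dist a b ≤ dist a (e i) + ‖e i - e l‖ + dist b (e l) := by
    rw [← dist_eq_norm, dist_comm b]
    exact dist_triangle4 _ _ _ _
  obtain ⟨hfa, hfb⟩ := hfr (dist a b / 100) (by positivity)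
  refine h (k, i, l) f ⟨hfa.mono fun n hn => ⟨hf, ?_⟩, hfb.mono fun n hn => ⟨hf, ?_⟩⟩
  · rw [← dist_eq_norm] at hn ⊢
    linarith [dist_triangle (f (x (φ n))) a (e i)]
  · rw [← dist_eq_norm] at hn ⊢
    linarith [dist_triangle (f (x (φ n))) b (e l)]

end Rosenthal

/-! ### Continuous seminorms and bounded hulls. -/

section Seminorms

variable {𝕜 : Type*} [RCLike 𝕜] {V : Type*} [AddCommGroup V] [Module 𝕜 V]

theorem seminorm_le_of_lt_one {p q : Seminorm 𝕜 V} (h : ∀ v, p v < 1 → q v ≤ 1) (v : V) :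
    q v ≤ p v := by
  refine le_of_forall_pos_le_add fun ε hε => ?_
  have ht : 0 < p v + ε := add_pos_of_nonneg_of_pos (apply_nonneg p v) hε
  have hn : ‖((p v + ε : ℝ) : 𝕜)⁻¹‖ = (p v + ε)⁻¹ := by
    rw [norm_inv, RCLike.norm_ofReal, abs_of_pos ht]
  have h1 := h (((p v + ε : ℝ) : 𝕜)⁻¹ • v) (by
    rw [map_smul_eq_mul, hn, inv_mul_lt_one₀ ht]
    linarith)
  rwa [map_smul_eq_mul, hn, inv_mul_le_one₀ ht] at h1

variable [TopologicalSpace V]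

theorem exists_continuous_seminorm_lt_one_subset [PolynormableSpace 𝕜 V] {U : Set V}
    (hU : U ∈ 𝓝 (0 : V)) : ∃ q : Seminorm 𝕜 V, Continuous q ∧ ∀ v, q v < 1 → v ∈ U := by
  have hws := PolynormableSpace.withSeminorms 𝕜 V
  have := hws.topologicalAddGroup
  obtain ⟨⟨s, r⟩, hr, hs⟩ := hws.hasBasis_zero_ball.mem_iff.1 hU
  replace hr : 0 < r := hr
  refine ⟨(r⁻¹).toNNReal • s.sup fun q : {q : Seminorm 𝕜 V // Continuous q} => q.1,
    Continuous.const_smul (Seminorm.continuous_finsetSup fun q _ => q.2) _, fun v hv => hs ?_⟩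
  change ((r⁻¹).toNNReal : ℝ) * _ < 1 at hv
  rw [Real.coe_toNNReal _ (inv_nonneg.2 hr.le), inv_mul_lt_one₀ hr] at hv
  rwa [Seminorm.mem_ball_zero]

theorem exists_seq_seminorm_forall_clm_le [PolynormableSpace 𝕜 V] [FirstCountableTopology V] :
    ∃ p : ℕ → Seminorm 𝕜 V, (∀ k, Continuous (p k)) ∧
      ∀ f : V →L[𝕜] 𝕜, ∃ k, ∀ v, ‖f v‖ ≤ p k v := by
  obtain ⟨B, hB⟩ := (𝓝 (0 : V)).exists_antitone_basis
  choose p hp hpB using fun n =>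
    exists_continuous_seminorm_lt_one_subset (𝕜 := 𝕜) (hB.1.mem_of_mem (i := n) trivial)
  refine ⟨p, hp, fun f => ?_⟩
  have hU : {v | ‖f v‖ < 1} ∈ 𝓝 (0 : V) :=
    (isOpen_lt f.continuous.norm continuous_const).mem_nhds (by simp)
  obtain ⟨k, -, hk⟩ := hB.1.mem_iff.1 hU
  exact ⟨k, seminorm_le_of_lt_one (q := f.toSeminorm) fun v hv => (hk (hpB k v hv)).le⟩

theorem bddAbove_seminorm_of_isVonNBounded [PolynormableSpace 𝕜 V] {B : Set V}
    (hB : IsVonNBounded 𝕜 B) (q : Seminorm 𝕜 V) (hq : Continuous q) :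
    ∃ M, ∀ v ∈ B, q v ≤ M := by
  obtain ⟨M, -, hM⟩ :=
    (PolynormableSpace.withSeminorms 𝕜 V).isVonNBounded_iff_seminorm_bounded.1 hB ⟨q, hq⟩
  exact ⟨M, fun v hv => (hM v hv).le⟩

/-- The set of points where each continuous seminorm is at most its supremum over the sequence
`x`. -/
def seminormHull (𝕜 : Type*) [RCLike 𝕜] {V : Type*} [AddCommGroup V] [Module 𝕜 V]
    [TopologicalSpace V] (x : ℕ → V) : Set V :=
  {v | ∀ q : Seminorm 𝕜 V, Continuous q → ∀ M, (∀ n, q (x n) ≤ M) → q v ≤ M}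

theorem isVonNBounded_seminormHull [PolynormableSpace 𝕜 V] {x : ℕ → V}
    (hx : IsVonNBounded 𝕜 (Set.range x)) : IsVonNBounded 𝕜 (seminormHull 𝕜 x) := by
  refine (PolynormableSpace.withSeminorms 𝕜 V).isVonNBounded_iff_seminorm_bounded.2 fun q => ?_
  obtain ⟨M, hM⟩ := bddAbove_seminorm_of_isVonNBounded hx q.1 q.2
  refine ⟨max M 0 + 1, by positivity, fun v hv => ?_⟩
  have := hv q.1 q.2 M fun n => hM _ ⟨n, rfl⟩
  exact lt_of_le_of_lt (this.trans (le_max_left _ _)) (lt_add_one _)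

theorem mem_seminormHull (x : ℕ → V) (n : ℕ) : x n ∈ seminormHull 𝕜 x :=
  fun _ _ _ hM => hM n

end Seminorms

/-! ### Operators on `ℓ₁` defined by bounded sequences. -/

section LOneOperator

variable {𝕜 : Type*} [RCLike 𝕜] {V : Type*} [AddCommGroup V] [Module 𝕜 V] [UniformSpace V]
  [IsUniformAddGroup V] [PolynormableSpace 𝕜 V] [CompleteSpace V]

theorem hasSum_norm_lp_one (a : lp (fun _ : ℕ => 𝕜) 1) : HasSum (fun i => ‖a i‖) ‖a‖ := by
  simpa using lp.hasSum_norm (p := 1) (by norm_num) a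

theorem summable_lp_one_smul {x : ℕ → V} (hx : IsVonNBounded 𝕜 (Set.range x))
    (a : lp (fun _ : ℕ => 𝕜) 1) : Summable fun i => a i • x i := by
  rw [summable_iff_vanishing]
  intro U hU
  obtain ⟨q, hq, hqU⟩ := exists_continuous_seminorm_lt_one_subset (𝕜 := 𝕜) hU
  obtain ⟨M, hM⟩ := bddAbove_seminorm_of_isVonNBounded hx q hq
  have hs := (hasSum_norm_lp_one a).summable.mul_right M
  obtain ⟨s, hs⟩ := summable_iff_vanishing.1 hs (Set.Iio 1) (Iio_mem_nhds one_pos)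
  refine ⟨s, fun t ht => hqU _ (lt_of_le_of_lt ?_ (hs t ht))⟩
  refine (Finset.le_sum_of_subadditive q (map_zero q).le (map_add_le_add q) _ _).trans (Finset.sum_le_sum fun i _ => ?_)
  rw [map_smul_eq_mul]
  exact mul_le_mul_of_nonneg_left (hM _ ⟨i, rfl⟩) (norm_nonneg _)

variable [ContinuousSMul 𝕜 V] [T2Space V]

/-- The operator on `ℓ₁` that maps the unit vectors to a given bounded sequence. -/
noncomputable def lpOneLift {x : ℕ → V} (hx : IsVonNBounded 𝕜 (Set.range x)) :
    lp (fun _ : ℕ => 𝕜) 1 →ₗ[𝕜] V where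
  toFun a := ∑' i, a i • x i
  map_add' a b := by
    rw [← (summable_lp_one_smul hx a).tsum_add (summable_lp_one_smul hx b)]
    simp [add_smul]
  map_smul' c a := by
    rw [RingHom.id_apply, ← (summable_lp_one_smul hx a).tsum_const_smul]
    simp [mul_smul]

theorem lpOneLift_single {x : ℕ → V} (hx : IsVonNBounded 𝕜 (Set.range x)) (k : ℕ) :
    lpOneLift hx (lp.single 1 k (1 : 𝕜)) = x k := by
  change ∑' i, (lp.single 1 k (1 : 𝕜) : ∀ _ : ℕ, 𝕜) i • x i = x k
  rw [tsum_eq_single k fun i hi => by simp [hi]]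
  simp

theorem hasSum_lpOneLift {x : ℕ → V} (hx : IsVonNBounded 𝕜 (Set.range x))
    (a : lp (fun _ : ℕ => 𝕜) 1) : HasSum (fun i => a i • x i) (lpOneLift hx a) :=
  (summable_lp_one_smul hx a).hasSum

theorem seminorm_lpOneLift_le {x : ℕ → V} (hx : IsVonNBounded 𝕜 (Set.range x))
    {q : Seminorm 𝕜 V} (hq : Continuous q) {M : ℝ} (hM : ∀ n, q (x n) ≤ M)
    (a : lp (fun _ : ℕ => 𝕜) 1) : q (lpOneLift hx a) ≤ ‖a‖ * M := by
  refine le_of_tendsto_of_tendsto' ((hq.tendsto _).comp (hasSum_lpOneLift hx a))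
    ((hasSum_norm_lp_one a).mul_right M) fun s => ?_
  refine (Finset.le_sum_of_subadditive q (map_zero q).le (map_add_le_add q) _ _).trans (Finset.sum_le_sum fun i _ => ?_)
  rw [map_smul_eq_mul]
  exact mul_le_mul_of_nonneg_left (hM i) (norm_nonneg _)

theorem le_seminorm_lpOneLift {x : ℕ → V} (hx : IsVonNBounded 𝕜 (Set.range x))
    {q : Seminorm 𝕜 V} (hq : Continuous q) {δ : ℝ}
    (h : ∀ (s : Finset ℕ) (a : ℕ → 𝕜), δ * ∑ i ∈ s, ‖a i‖ ≤ q (∑ i ∈ s, a i • x i))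
    (a : lp (fun _ : ℕ => 𝕜) 1) : δ * ‖a‖ ≤ q (lpOneLift hx a) :=
  le_of_tendsto_of_tendsto' ((hasSum_norm_lp_one a).const_mul δ |>.congr fun s => by
      rw [Finset.mul_sum]) ((hq.tendsto _).comp (hasSum_lpOneLift hx a)) fun s => h s a

theorem continuous_lpOneLift {x : ℕ → V} (hx : IsVonNBounded 𝕜 (Set.range x)) :
    Continuous (lpOneLift hx) := by
  refine (PolynormableSpace.withSeminorms 𝕜 V).continuous_normedSpace_dom _ _ fun q => ?_
  obtain ⟨M, hM⟩ := bddAbove_seminorm_of_isVonNBounded hx q.1 q.2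
  refine ⟨M.toNNReal, fun a => ?_⟩
  have h := seminorm_lpOneLift_le hx q.2 (M := M.toNNReal)
    (fun n => (hM _ ⟨n, rfl⟩).trans (Real.le_coe_toNNReal M)) a
  rw [mul_comm] at h
  exact h

end LOneOperator

/-! ### Transfer from a step to `E`, and copies of `ℓ₁`. -/

section Main

/-- A linear map from a normed space into a locally convex space which is bounded below by a
continuous seminorm is an embedding. -/
theorem isEmbedding_of_norm_le_seminorm {𝕜 : Type*} [RCLike 𝕜] {X : Type*} [NormedAddCommGroup X]
    [NormedSpace 𝕜 X] {V : Type*} [AddCommGroup V] [Module 𝕜 V] [TopologicalSpace V]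
    [IsTopologicalAddGroup V] (T : X →L[𝕜] V) (q : Seminorm 𝕜 V) (hq : Continuous q)
    (h : ∀ a, ‖a‖ ≤ q (T a)) : IsEmbedding T := by
  refine ⟨isInducing_iff_nhds.2 fun a => le_antisymm (T.continuous.tendsto a).le_comap ?_, ?_⟩
  · intro U hU
    obtain ⟨ε, hε, hU⟩ := Metric.mem_nhds_iff.1 hU
    have hopen : IsOpen {v | q (v - T a) < ε} :=
      isOpen_lt (hq.comp (continuous_id.sub continuous_const)) continuous_const
    refine ⟨_, hopen.mem_nhds (by simpa using hε), fun b hb => hU ?_⟩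
    rw [mem_ball_iff_norm]
    refine (h (b - a)).trans_lt ?_
    rw [map_sub]
    exact hb
  · intro a b hab
    have := h (a - b)
    rw [map_sub, hab, sub_self, map_zero] at this
    exact sub_eq_zero.1 (norm_le_zero_iff.1 this)

theorem isEquivUnitVectorBasisL1_of_lower_bound {𝕜 : Type*} [RCLike 𝕜]
    {E : Type*} [AddCommGroup E] [Module 𝕜 E] [TopologicalSpace E] [IsTopologicalAddGroup E]
    [PolynormableSpace 𝕜 E] {V : Type*} [AddCommGroup V] [Module 𝕜 V]
    [UniformSpace V] [IsUniformAddGroup V] [ContinuousSMul 𝕜 V] [PolynormableSpace 𝕜 V]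
    [CompleteSpace V] [T2Space V] (J : V →L[𝕜] E) {B : Set E} {x : ℕ → E}
    (hxB : seminormHull 𝕜 x ⊆ B) (hJ : IsInducing fun y : (J ⁻¹' B : Set V) => J y)
    {y : ℕ → V} (hyx : ∀ n, J (y n) = x n) (hy : IsVonNBounded 𝕜 (Set.range y))
    {p : Seminorm 𝕜 V} (hp : Continuous p) {δ : ℝ} (hδ : 0 < δ)
    (h : ∀ (s : Finset ℕ) (a : ℕ → 𝕜), δ * ∑ i ∈ s, ‖a i‖ ≤ p (∑ i ∈ s, a i • y i)) :
    IsEquivUnitVectorBasisL1 𝕜 x := by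
  let T : lp (fun _ : ℕ => 𝕜) 1 →L[𝕜] E :=
    J.comp ⟨lpOneLift hy, continuous_lpOneLift hy⟩
  have hT : ∀ a, T a = J (lpOneLift hy a) := fun a => rfl
  -- This puts the image of the unit ball where the topologies of `V` and `E` agree.
  have hTB : ∀ a, ‖a‖ ≤ 1 → T a ∈ B := by
    intro a ha
    refine hxB fun q hq M hM => ?_
    have := seminorm_lpOneLift_le hy (q := q.comp J.toLinearMap) (hq.comp J.continuous)
      (M := M) (fun n => by simpa [hyx] using hM n) a
    have hM0 : 0 ≤ M := (apply_nonneg q _).trans (hM 0)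
    exact this.trans (mul_le_of_le_one_left hM0 ha)
  have h0B : (0 : V) ∈ J ⁻¹' B := by simpa [hT] using hTB 0 (by simp)
  have hnhds : {v : (J ⁻¹' B : Set V) | p v < δ / 2} ∈ 𝓝 (⟨0, h0B⟩ : (J ⁻¹' B : Set V)) :=
    (isOpen_lt (hp.comp continuous_subtype_val) continuous_const).mem_nhds (by
      simpa using half_pos hδ)
  rw [hJ.nhds_eq_comap] at hnhds
  obtain ⟨U, hU, hUp⟩ := hnhds
  rw [show J ((⟨0, h0B⟩ : (J ⁻¹' B : Set V)) : V) = 0 from map_zero J] at hU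
  obtain ⟨q, hq, hqU⟩ := exists_continuous_seminorm_lt_one_subset (𝕜 := 𝕜) hU
  have hsmall : ∀ a, ‖a‖ ≤ 1 → q (T a) < 1 → ‖a‖ < 1 / 2 := by
    intro a ha hqa
    have h1 : p (lpOneLift hy a) < δ / 2 :=
      hUp (a := ⟨lpOneLift hy a, hTB a ha⟩) (hqU _ hqa)
    have h2 := le_seminorm_lpOneLift hy hp h a
    by_contra! hcon
    nlinarith
  -- `hsmall` only controls the unit ball. If `‖a‖ > 1` and `q (T a) < 1`, normalizing `a` gives a
  -- unit vector of norm below `1/2`.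
  have hnorm : ∀ a, ‖a‖ ≤ q (T a) := by
    have hcomp := seminorm_le_of_lt_one (p := q.comp T.toLinearMap)
      (q := normSeminorm 𝕜 (lp (fun _ : ℕ => 𝕜) 1)) fun a ha => by
        replace ha : q (T a) < 1 := ha
        by_contra! hcon
        replace hcon : 1 < ‖a‖ := hcon
        have hn : ‖((‖a‖ : ℝ) : 𝕜)⁻¹‖ = ‖a‖⁻¹ := by simp
        have h1 : ‖((‖a‖ : ℝ) : 𝕜)⁻¹ • a‖ = 1 := by
          rw [norm_smul, hn, inv_mul_cancel₀ (by linarith)]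
        have h2 := hsmall _ h1.le (by
          rw [map_smul, map_smul_eq_mul, hn]
          have := inv_le_one_of_one_le₀ hcon.le
          exact (mul_le_of_le_one_left (apply_nonneg q _) this).trans_lt ha)
        linarith
    exact hcomp
  exact ⟨T, isEmbedding_of_norm_le_seminorm T q hq hnorm, fun k => by
    rw [hT, lpOneLift_single, hyx]⟩

theorem IsEquivUnitVectorBasisL1.containsCopyL1 {𝕜 : Type*} [RCLike 𝕜] {E : Type*}
    [AddCommGroup E] [Module 𝕜 E] [TopologicalSpace E] {x : ℕ → E}
    (hx : IsEquivUnitVectorBasisL1 𝕜 x) : ContainsCopyL1 𝕜 E := by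
  obtain ⟨T, hT, -⟩ := hx
  let e := LinearEquiv.ofInjective T.toLinearMap hT.injective
  refine ⟨LinearMap.range T.toLinearMap, ⟨{ e with
    continuous_toFun := T.continuous.subtype_mk _
    continuous_invFun := hT.isInducing.continuous_iff.2 ?_ }⟩⟩
  refine continuous_subtype_val.congr fun y => ?_
  exact (congrArg Subtype.val (e.apply_symm_apply y)).symm

/-- For any subsequence of the unit vectors, the functional on `ℓ₁` with coefficient `1` at its
even-numbered members and `0` elsewhere oscillates along it; Hahn–Banach extends this functional
from the copy to `E`. -/
theorem not_containsCopyL1_of_weaklyCauchy {𝕜 : Type*} [RCLike 𝕜] {E : Type*}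
    [AddCommGroup E] [Module 𝕜 E] [TopologicalSpace E] [PolynormableSpace 𝕜 E]
    (h : ∀ x : ℕ → E, IsVonNBounded 𝕜 (Set.range x) →
      ∃ φ : ℕ → ℕ, StrictMono φ ∧ IsWeaklyCauchySeq 𝕜 (x ∘ φ)) : ¬ ContainsCopyL1 𝕜 E := by
  classical
  rintro ⟨S, ⟨e⟩⟩
  have hb : IsVonNBounded 𝕜 (Set.range fun n : ℕ =>
      (lp.single 1 n (1 : 𝕜) : lp (fun _ : ℕ => 𝕜) 1)) := by
    refine (NormedSpace.isVonNBounded_iff' 𝕜).2 ⟨1, ?_⟩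
    rintro _ ⟨n, rfl⟩
    simp
  have hbE := hb.image (S.subtypeL.comp (e : lp (fun _ : ℕ => 𝕜) 1 →L[𝕜] S))
  rw [← Set.range_comp] at hbE
  obtain ⟨φ, hφ, hC⟩ := h _ hbE
  let s : ℕ → 𝕜 := fun i => if ∃ n, Even n ∧ φ n = i then 1 else 0
  have hs : IsVonNBounded 𝕜 (Set.range s) := by
    refine (NormedSpace.isVonNBounded_iff' 𝕜).2 ⟨1, ?_⟩
    rintro _ ⟨n, rfl⟩
    by_cases hn : ∃ k, Even k ∧ φ k = n <;> simp [s, hn]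
  let g : lp (fun _ : ℕ => 𝕜) 1 →L[𝕜] 𝕜 := ⟨lpOneLift hs, continuous_lpOneLift hs⟩
  obtain ⟨f, hf⟩ := StrongDual.exists_extension S (g.comp (e.symm : S →L[𝕜] _))
  have hval : ∀ n, f (S.subtypeL.comp (e : lp (fun _ : ℕ => 𝕜) 1 →L[𝕜] S)
      (lp.single 1 (φ n) (1 : 𝕜))) = if Even n then 1 else 0 := by
    intro n
    refine (hf (e (lp.single 1 (φ n) (1 : 𝕜)))).trans ?_
    refine (congrArg g (e.symm_apply_apply _)).trans ((lpOneLift_single hs _).trans ?_)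
    simp [s, hφ.injective.eq_iff]
  obtain ⟨N, hN⟩ := Metric.cauchySeq_iff.1 (hC f) 1 one_pos
  have h1 := hN (2 * N) (by omega) (2 * N + 1) (by omega)
  have h2 : dist (if Even (2 * N) then (1 : 𝕜) else 0) (if Even (2 * N + 1) then 1 else 0) < 1 := by
    rw [← hval, ← hval]
    exact h1
  simp at h2

end Main
theorem mainTheorem6 {𝕜 : Type*} [RCLike 𝕜]
    {E : Type*} [AddCommGroup E] [Module 𝕜 E] [TopologicalSpace E] [IsTopologicalAddGroup E]
    [ContinuousSMul 𝕜 E] [PolynormableSpace 𝕜 E] [T2Space E]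
    {F : ℕ → Type*} [∀ n, AddCommGroup (F n)] [∀ n, Module 𝕜 (F n)]
    [∀ n, UniformSpace (F n)] [∀ n, IsUniformAddGroup (F n)] [∀ n, ContinuousSMul 𝕜 (F n)]
    [∀ n, PolynormableSpace 𝕜 (F n)] [∀ n, CompleteSpace (F n)]
    [∀ n, TopologicalSpace.MetrizableSpace (F n)]
    (j : ∀ n, F n →ₗ[𝕜] E) (hE : IsLocallyConvexInductiveLimit j)
    (hret : IsBoundedlyRetractive j) :
    (∀ x : ℕ → E, IsVonNBounded 𝕜 (Set.range x) →
      ∃ φ : ℕ → ℕ, StrictMono φ ∧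
        (IsWeaklyCauchySeq 𝕜 (x ∘ φ) ∨ IsEquivUnitVectorBasisL1 𝕜 (x ∘ φ))) ∧
    (¬ ContainsCopyL1 𝕜 E ↔
      ∀ x : ℕ → E, IsVonNBounded 𝕜 (Set.range x) →
        ∃ φ : ℕ → ℕ, StrictMono φ ∧ IsWeaklyCauchySeq 𝕜 (x ∘ φ)) := by
  have hfirst : ∀ x : ℕ → E, IsVonNBounded 𝕜 (Set.range x) →
      ∃ φ : ℕ → ℕ, StrictMono φ ∧
        (IsWeaklyCauchySeq 𝕜 (x ∘ φ) ∨ IsEquivUnitVectorBasisL1 𝕜 (x ∘ φ)) := by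
    intro x hx
    obtain ⟨m, hrange, hbdd, hind⟩ := hret _ (isVonNBounded_seminormHull hx)
    let J : F m →L[𝕜] E := ⟨j m, hE.continuous_incl m⟩
    choose y hy using fun n => hrange (mem_seminormHull (𝕜 := 𝕜) x n)
    have hyb : IsVonNBounded 𝕜 (Set.range y) := hbdd.subset (by
      rintro _ ⟨n, rfl⟩
      change j m (y n) ∈ seminormHull 𝕜 x
      rw [hy n]
      exact mem_seminormHull x n)
    obtain ⟨p, hp, hpf⟩ := exists_seq_seminorm_forall_clm_le (𝕜 := 𝕜) (V := F m)
    obtain ⟨φ, hφ, ⟨k, δ, hδ, hlow⟩ | hC⟩ := exists_subseq_lower_bound_or_cauchySeq p y fun k => by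
      obtain ⟨M, hM⟩ := bddAbove_seminorm_of_isVonNBounded hyb (p k) (hp k)
      exact ⟨M, fun n => hM _ ⟨n, rfl⟩⟩
    · refine ⟨φ, hφ, Or.inr ?_⟩
      refine isEquivUnitVectorBasisL1_of_lower_bound J (B := seminormHull 𝕜 x)
        -- The hull of a subsequence lies in the hull of `x`, so the step chosen before extraction
        -- still serves.
        (fun v hv q hq M hM => hv q hq M fun n => hM (φ n)) hind (y := y ∘ φ)
        (fun n => hy (φ n)) (hyb.subset ?_) (hp k) hδ hlow
      exact Set.range_comp_subset_range φ y
    · refine ⟨φ, hφ, Or.inl fun f => ?_⟩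
      have := hC (f.comp J).toLinearMap (hpf (f.comp J))
      convert this using 2 with n
      exact (congrArg f (hy (φ n))).symm
  refine ⟨hfirst, fun hno x hx => ?_, not_containsCopyL1_of_weaklyCauchy⟩
  obtain ⟨φ, hφ, h | h⟩ := hfirst x hx
  · exact ⟨φ, hφ, h⟩
  · exact absurd h.containsCopyL1 hno
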